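/- Theorem (Approximation of symmetric states by product states). Let $d \ge 0$, $n \ge 1$ and $0 \le k \le n$ be integers. Let $\xi^n$ be a density operator (positive semidefinite, trace one) on $(\mathbb{C}^d)^{\otimes n}$ that is permutation-invariant, that is, $\pi\,\xi^n\,\pi^\dagger = \xi^n$ for every $\pi \in S_n$, where $\pi$ acts on $(\mathbb{C}^d)^{\otimes n}$ by permuting the tensor factors, $\pi\,(e_{i_1}\otimes\cdots\otimes e_{i_n}) = e_{i_{\pi^{-1}(1)}}\otimes\cdots\otimes e_{i_{\pi^{-1}(n)}}$. Let $\xi^k := \mathrm{tr}_{n-k}(\xi^n)$ be the partial trace over the last $n-k$ tensor factors. Let $\mathcal{P}^k(\mathbb{C}^d)$ be the set of operators on $(\mathbb{C}^d)^{\otimes k}$ of the form $\int \sigma^{\otimes k}\,dm(\sigma)$, where $m$ is a Borel probability measure on the set of density operators on $\mathbb{C}^d$. Then $\xi^k$ is $\varepsilon$-close to $\mathcal{P}^k(\mathbb{C}^d)$ in trace distance for $\varepsilon := 2\,\frac{d^2 k}{n}$: there is $\tau \in \mathcal{P}^k(\mathbb{C}^d)$ with $$\tfrac12\,\mathrm{tr}\,\bigl|\xi^k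 - \tau\bigr| \;\le\; 2\,\frac{d^2 k}{n}.$$ -/

import Mathlib

open MeasureTheory
open scoped Matrix MatrixOrder ComplexOrder

noncomputable section

namespace DeFinetti

/-- Operators on `(ℂ^d)^{⊗n}`, written as matrices in the product basis
`e_{f 0} ⊗ ⋯ ⊗ e_{f (n-1)}`, which is indexed by the functions `f : Fin n → Fin d`. -/
abbrev TensorOp (d n : ℕ) : Type := Matrix (Fin n → Fin d) (Fin n → Fin d) ℂ

/-- Density operators (states): positive semidefinite (in particular hermitian) of trace one. -/
def IsDensity {ι : Type*} [Fintype ι] (ρ : Matrix ι ι ℂ) : Prop :=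
  ρ.PosSemidef ∧ ρ.trace = 1

/-- The (mixed) states on `ℂ^d`. -/
def State (d : ℕ) : Type := {σ : Matrix (Fin d) (Fin d) ℂ // IsDensity σ}

/-- The topology of the set of states, inherited from the space of matrices. -/
instance (d : ℕ) : TopologicalSpace (State d) :=
  inferInstanceAs (TopologicalSpace {σ : Matrix (Fin d) (Fin d) ℂ // IsDensity σ})

/-- The set of states carries its Borel σ-algebra. -/
instance (d : ℕ) : MeasurableSpace (State d) := borel (State d)

instance (d : ℕ) : BorelSpace (State d) := ⟨rfl⟩

/-- The unitary by which a permutation `π` permutes the `n` tensor factors: it maps the basis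
vector with index `g` to the one with index `g ∘ π⁻¹`. -/
def permOp (d : ℕ) {n : ℕ} (π : Equiv.Perm (Fin n)) : TensorOp d n :=
  Matrix.of fun f g => if f = g ∘ ⇑π⁻¹ then 1 else 0

/-- `π ξ π† = ξ` for every permutation `π` of the `n` tensor factors. -/
def IsPermInvariant {d n : ℕ} (ξ : TensorOp d n) : Prop :=
  ∀ π : Equiv.Perm (Fin n), permOp d π * ξ * (permOp d π)ᴴ = ξ

/-- The index of the product basis vector of `(ℂ^d)^{⊗n}` that is the tensor product of the
vector with index `f` on the first `k` factors and the one with index `w` on the last `n - k`. -/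
def joinIndex {d n k : ℕ} (hk : k ≤ n) (f : Fin k → Fin d) (w : Fin (n - k) → Fin d) :
    Fin n → Fin d :=
  Fin.append f w ∘ Fin.cast (Nat.add_sub_of_le hk).symm

/-- The partial trace `tr_{n-k}` over the last `n - k` tensor factors. -/
def partialTrace {d n k : ℕ} (hk : k ≤ n) (ξ : TensorOp d n) : TensorOp d k :=
  Matrix.of fun f g => ∑ w : Fin (n - k) → Fin d, ξ (joinIndex hk f w) (joinIndex hk g w)

/-- The tensor power `σ^{⊗k}`. -/
def tensorPow {d : ℕ} (k : ℕ) (σ : Matrix (Fin d) (Fin d) ℂ) : TensorOp d k :=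
  Matrix.of fun f g => ∏ i, σ (f i) (g i)

/-- The mixture `∫ σ^{⊗k} dm(σ)`. The integral of an operator-valued function is taken entry by
entry (the entries are continuous and bounded on the set of states). -/
def mixture {d : ℕ} (k : ℕ) (m : Measure (State d)) : TensorOp d k :=
  Matrix.of fun f g => ∫ σ : State d, tensorPow k σ.1 f g ∂m

/-- The set `𝒫^k(ℂ^d)` of all mixtures `∫ σ^{⊗k} dm(σ)`, with `m` a probability measure on the
set of states on `ℂ^d`. -/
def productMixtures (d k : ℕ) : Set (TensorOp d k) :=
  {τ | ∃ m : Measure (State d), IsProbabilityMeasure m ∧ τ = mixture k m}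

/-- The trace distance `½ tr |A - B|`, where `|X|` is the positive square root of `X† X`. -/
def traceDist {ι : Type*} [Fintype ι] [DecidableEq ι] (A B : Matrix ι ι ℂ) : ℝ :=
  (1 / 2 : ℝ) * (CFC.abs (A - B)).trace.re

end DeFinetti

end

noncomputable section

namespace DeFinetti

/-! The state is purified, and the symmetric purification is compared with product vectors through
the moments of the unit sphere. Put `D = d ^ 2`. As a vector of `(ℂ^d ⊗ ℂ^d)^{⊗n}`, the square root
of `ξ` is a purification `Ψ` of `ξ`. It is symmetric, because positive square roots are unique and
so inherit the invariance of `ξ`.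

On symmetric vectors of `m` factors, `∫ |φ^{⊗m}⟩⟨φ^{⊗m}|` over the sphere of `ℂ^D` acts as a scalar
`K_m`, proportional to `m! / (m + D - 1)!`, hence to the inverse dimension of the symmetric
subspace. With `l = n - k`, the vector `⟨φ^{⊗l}, Ψ⟩` on the first `k` factors minus its component
`φ^{⊗k} ⟨φ^{⊗n}, Ψ⟩` along `φ^{⊗k}` spans a positive operator; its average over `φ` is computed by
these moments (`posSemidef_deFinetti`). After the purifying factors are traced out, `φ^{⊗k}` becomes
`σ_φ^{⊗k}`, with `σ_φ` the reduced state of `φ`. Division by `K_l` gives `(1 - 2s) ξ^k + s τ ≥ 0`,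
where `s = K_n / K_l` and `τ` is the mixture of the `σ_φ^{⊗k}` with density `|⟨φ^{⊗n}, Ψ⟩|² / K_n`.

This one-sided inequality suffices: it exhibits `ξ^k - τ` as a difference of two positive operators
of trace `2 (1 - s)` each, so the trace distance is at most `2 (1 - s)`. Finally `1 - s ≤ D k / n`
(`one_sub_dim_ratio_le`). -/

/-! ### Trace norm of a difference of positive matrices -/

/-- The trace norm of a difference of positive semidefinite matrices is at most the sum of the
traces. -/
theorem trace_abs_sub_le {ι : Type*} [Fintype ι] [DecidableEq ι] {P Q : Matrix ι ι ℂ}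
    (hP : P.PosSemidef) (hQ : Q.PosSemidef) :
    (CFC.abs (P - Q)).trace.re ≤ P.trace.re + Q.trace.re := by
  set X := P - Q with hX
  have hXs : IsSelfAdjoint X := (hP.1.sub hQ.1)
  -- With `S` the sign of `X`, `|X| = S X` and `-1 ≤ S ≤ 1`, so `tr |X| = tr S P - tr S Q ≤ tr P +
  -- tr Q`. The discontinuity of the sign is harmless on a finite spectrum.
  set S : Matrix ι ι ℂ := cfc (fun x : ℝ => (SignType.sign x : ℝ)) X with hS
  have hfin : (spectrum ℝ X).Finite := Matrix.finite_real_spectrum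
  have hc : ∀ f : ℝ → ℝ, ContinuousOn f (spectrum ℝ X) := fun f => hfin.continuousOn f
  have habs : CFC.abs X = S * X := by
    rw [CFC.abs_eq_cfc_norm X]
    conv_rhs => rw [hS]; arg 2; rw [← cfc_id ℝ X]
    rw [← cfc_mul _ _ X (hc _) (hc _)]
    congr 1
    ext x
    simp [sign_mul_self]
  have h1 : (1 - S).PosSemidef := by
    rw [← Matrix.nonneg_iff_posSemidef, sub_nonneg]
    refine cfc_le_one _ _ fun x _ => ?_
    rcases lt_trichotomy x 0 with h | h | h <;> simp [h]
  have h2 : (1 + S).PosSemidef := by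
    rw [← Matrix.nonneg_iff_posSemidef, ← neg_le_iff_add_nonneg', hS, ← cfc_const_one ℝ X,
      ← cfc_neg]
    refine cfc_mono (fun x _ => ?_) (hc _) (hc _)
    rcases lt_trichotomy x 0 with h | h | h <;> simp [h]
  have key : ∀ {A B : Matrix ι ι ℂ}, A.PosSemidef → B.PosSemidef → 0 ≤ (A * B).trace.re := by
    intro A B hA hB
    obtain ⟨C, rfl⟩ := CStarAlgebra.nonneg_iff_eq_star_mul_self.mp hB.nonneg
    rw [← Matrix.mul_assoc, Matrix.trace_mul_comm, ← Matrix.mul_assoc]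
    exact (Complex.nonneg_iff.mp (hA.mul_mul_conjTranspose_same C).trace_nonneg).1
  have e1 := key h1 hP
  have e2 := key h2 hQ
  rw [habs, hX]
  simp only [Matrix.sub_mul, Matrix.add_mul, Matrix.mul_sub, Matrix.one_mul, Matrix.trace_sub,
    Matrix.trace_add, Complex.sub_re, Complex.add_re] at *
  linarith

/-! ### Moments of the sphere from Gaussian integrals -/

open Metric in
/-- Polar coordinates for a homogeneous function times a radial one. -/
theorem integral_homogeneous_mul_radial {E : Type*} [NormedAddCommGroup E] [NormedSpace ℝ E]
    [MeasurableSpace E] [BorelSpace E] [FiniteDimensional ℝ E] [Nontrivial E]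
    (μ : Measure E) [μ.IsAddHaarMeasure] (p : ℕ) (h : E → ℂ)
    (hh : ∀ (r : ℝ) (x : E), 0 < r → h (r • x) = (r : ℂ) ^ p * h x) (g : ℝ → ℝ) :
    ∫ x, h x * (g ‖x‖ : ℂ) ∂μ = (∫ x : sphere (0 : E) 1, h x ∂μ.toSphere) *
      ((∫ r in Set.Ioi (0 : ℝ), r ^ (Module.finrank ℝ E - 1) * (r ^ p * g r) : ℝ) : ℂ) := by
  calc
    ∫ x, h x * (g ‖x‖ : ℂ) ∂μ
      = ∫ x : ({(0)}ᶜ : Set E), h x.1 * (g ‖x.1‖ : ℂ) ∂(μ.comap (↑)) := by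
      rw [integral_subtype_comap (measurableSet_singleton _).compl
        fun x => h x * (g ‖x‖ : ℂ), restrict_compl_singleton]
    _ = ∫ x, h x.1 * (((x.2 : ℝ) ^ p * g x.2 : ℝ) : ℂ)
          ∂μ.toSphere.prod (.volumeIoiPow (Module.finrank ℝ E - 1)) := by
      rw [← μ.measurePreserving_homeomorphUnitSphereProd.integral_comp
        (Homeomorph.measurableEmbedding _)]
      refine integral_congr_ae (.of_forall fun x => ?_)
      have hx : 0 < ‖x.1‖ := norm_pos_iff.mpr x.2
      have : h x.1 = (‖x.1‖ : ℂ) ^ p * h (‖x.1‖⁻¹ • x.1) := by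
        rw [← hh _ _ hx, smul_smul, mul_inv_cancel₀ hx.ne', one_smul]
      simp only [homeomorphUnitSphereProd_apply_snd_coe, homeomorphUnitSphereProd_apply_fst_coe]
      rw [this]
      push_cast
      ring
    _ = _ := by
      rw [integral_prod_mul (fun x : sphere (0 : E) 1 => h x)
        (fun r : Set.Ioi (0 : ℝ) => (((r : ℝ) ^ p * g r : ℝ) : ℂ)), integral_complex_ofReal]
      congr 2
      simp only [Measure.volumeIoiPow, ENNReal.ofReal]
      rw [integral_withDensity_eq_integral_smul,
        integral_subtype_comap measurableSet_Ioi fun a : ℝ =>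
          Real.toNNReal (a ^ (Module.finrank ℝ E - 1)) • (a ^ p * g a),
        setIntegral_congr_fun measurableSet_Ioi fun x hx => ?_]
      · rw [NNReal.smul_def, Real.coe_toNNReal _ (pow_nonneg (le_of_lt hx) _), smul_eq_mul]
      · exact (measurable_subtype_coe.pow_const _).real_toNNReal

/-- The moments of a complex Gaussian variable. -/
theorem integral_pow_mul_conj_pow_mul_exp (a b : ℕ) :
    ∫ z : ℂ, z ^ a * (starRingEnd ℂ z) ^ b * (Real.exp (-‖z‖ ^ 2) : ℂ) =
      if a = b then (Real.pi * a.factorial : ℂ) else 0 := by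
  split_ifs with hab
  · subst hab
    have h := Complex.integral_rpow_mul_exp_neg_rpow (p := 2) (q := 2 * a) (by norm_num)
      (by have : (0 : ℝ) ≤ a := a.cast_nonneg
          linarith)
    have e : ((2 * a : ℝ) + 2) / 2 = a + 1 := by ring
    rw [e, Real.Gamma_nat_eq_factorial] at h
    have : ∀ z : ℂ, z ^ a * (starRingEnd ℂ z) ^ a * (Real.exp (-‖z‖ ^ 2) : ℂ) =
        ((‖z‖ ^ (2 * a : ℝ) * Real.exp (-‖z‖ ^ (2 : ℝ)) : ℝ) : ℂ) := by
      intro z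
      rw [← mul_pow, Complex.mul_conj, Complex.normSq_eq_norm_sq, Real.rpow_mul (norm_nonneg _),
        Real.rpow_natCast, Real.rpow_ofNat]
      push_cast
      rfl
    simp_rw [this]
    rw [integral_complex_ofReal, h]
    push_cast
    ring
  · have hab' : (a : ℝ) - b ≠ 0 := sub_ne_zero.mpr (by exact_mod_cast hab)
    -- Rotation by `ω` preserves Lebesgue measure and multiplies the integrand by `ω ^ (a - b)`;
    -- this angle makes the factor `-1`, so the integral equals its own negative.
    set ω : Circle := Circle.exp (Real.pi / (a - b)) with hω
    have hω1 : (ω : ℂ) ^ a * (starRingEnd ℂ ω) ^ b = -1 := by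
      rw [← Circle.coe_inv_eq_conj, hω, ← Circle.exp_neg, Circle.coe_exp, Circle.coe_exp,
        ← Complex.exp_nat_mul, ← Complex.exp_nat_mul, ← Complex.exp_add, ← Complex.exp_pi_mul_I]
      congr 1
      have : (a : ℂ) - b ≠ 0 := by exact_mod_cast hab'
      push_cast
      field_simp
      ring
    have h := (rotation ω).measurePreserving.integral_comp
      (rotation ω).toHomeomorph.measurableEmbedding
      (fun z : ℂ => z ^ a * (starRingEnd ℂ z) ^ b * (Real.exp (-‖z‖ ^ 2) : ℂ))
    have h2 : ∀ z : ℂ, (rotation ω z) ^ a * (starRingEnd ℂ (rotation ω z)) ^ b *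
        (Real.exp (-‖rotation ω z‖ ^ 2) : ℂ) =
        -(z ^ a * (starRingEnd ℂ z) ^ b * (Real.exp (-‖z‖ ^ 2) : ℂ)) := by
      intro z
      rw [LinearIsometryEquiv.norm_map, rotation_apply, map_mul, mul_pow, mul_pow]
      linear_combination (z ^ a * (starRingEnd ℂ z) ^ b * (Real.exp (-‖z‖ ^ 2) : ℂ)) * hω1
    simp_rw [h2] at h
    rw [integral_neg] at h
    exact self_eq_neg.mp h.symm

/-- The permutations that turn one word into another are counted by the multiplicities of the
letters. -/
theorem sum_perm_comp_eq {ι α R : Type*} [Fintype ι] [DecidableEq ι] [Fintype α] [DecidableEq α]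
    [Semiring R] (F h : α → ι) :
    (∑ π : Equiv.Perm α, if F ∘ π = h then (1 : R) else 0) =
      if ∀ j, Fintype.card {i // F i = j} = Fintype.card {i // h i = j} then
        ((∏ j, (Fintype.card {i // F i = j}).factorial : ℕ) : R) else 0 := by
  split_ifs with H
  -- The solutions of `F ∘ π = h` form the coset of `π₀` under the stabilizer of `F`, whose order is
  -- a product of factorials.
  · let π₀ : Equiv.Perm α := Equiv.ofFiberEquiv fun j => Fintype.equivOfCardEq (H j).symm
    have hπ₀ : F ∘ π₀ = h := funext fun i => Equiv.ofFiberEquiv_map _ i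
    rw [← DomMulAct.stabilizer_card, Fintype.card_subtype, Finset.sum_ite, Finset.sum_const_zero,
      add_zero, Finset.sum_const, nsmul_one]
    congr 1
    refine Finset.card_bij' (fun π _ => π * π₀⁻¹) (fun σ _ => σ * π₀) ?_ ?_ ?_ ?_
    · intro π hπ
      simp only [Finset.mem_filter, Finset.mem_univ, true_and] at hπ ⊢
      rw [Equiv.Perm.coe_mul, ← Function.comp_assoc, hπ, ← hπ₀, Function.comp_assoc,
        ← Equiv.Perm.coe_mul, mul_inv_cancel, Equiv.Perm.coe_one, Function.comp_id]
    · intro σ hσ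
      simp only [Finset.mem_filter, Finset.mem_univ, true_and] at hσ ⊢
      rw [Equiv.Perm.coe_mul, ← Function.comp_assoc, hσ, hπ₀]
    · intro π _
      simp
    · intro σ _
      simp
  · refine Finset.sum_eq_zero fun π _ => if_neg fun hπ => H fun j => ?_
    subst hπ
    exact Fintype.card_congr (π.symm.subtypeEquiv fun i => by simp)

theorem prod_comp_eq_prod_pow {ι α M : Type*} [Fintype ι] [DecidableEq ι] [Fintype α]
    [CommMonoid M] (F : α → ι) (z : ι → M) :
    ∏ i, z (F i) = ∏ j, z j ^ Fintype.card {i // F i = j} := by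
  rw [← Finset.prod_fiberwise Finset.univ F]
  refine Finset.prod_congr rfl fun j _ => ?_
  rw [Fintype.card_subtype, ← Finset.prod_const]
  exact Finset.prod_congr rfl fun i hi => by rw [(Finset.mem_filter.mp hi).2]

/-- Wick's formula for independent complex Gaussian variables. -/
theorem integral_prod_mul_conj_mul_exp {ι α : Type*} [Fintype ι] [DecidableEq ι] [Fintype α]
    [DecidableEq α] (F h : α → ι) :
    ∫ z : ι → ℂ, (∏ i, z (F i)) * (∏ i, starRingEnd ℂ (z (h i))) *
        (Real.exp (-∑ j, ‖z j‖ ^ 2) : ℂ) =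
      (Real.pi : ℂ) ^ Fintype.card ι *
        ∑ π : Equiv.Perm α, if F ∘ π = h then (1 : ℂ) else 0 := by
  have e : ∀ z : ι → ℂ, (∏ i, z (F i)) * (∏ i, starRingEnd ℂ (z (h i))) *
      (Real.exp (-∑ j, ‖z j‖ ^ 2) : ℂ) =
      ∏ j, (z j ^ Fintype.card {i // F i = j} *
        (starRingEnd ℂ (z j)) ^ Fintype.card {i // h i = j} * (Real.exp (-‖z j‖ ^ 2) : ℂ)) := by
    intro z
    rw [Finset.prod_mul_distrib, Finset.prod_mul_distrib, ← prod_comp_eq_prod_pow F z,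
      ← prod_comp_eq_prod_pow h fun j => starRingEnd ℂ (z j), ← Finset.sum_neg_distrib,
      Real.exp_sum, Complex.ofReal_prod]
  simp_rw [e]
  rw [integral_fintype_prod_volume_eq_prod (f := fun j (x : ℂ) =>
    x ^ Fintype.card {i // F i = j} *
        (starRingEnd ℂ x) ^ Fintype.card {i // h i = j} * (Real.exp (-‖x‖ ^ 2) : ℂ))]
  simp_rw [integral_pow_mul_conj_pow_mul_exp]
  rw [sum_perm_comp_eq]
  split_ifs with H
  · rw [Finset.prod_congr rfl fun j _ => if_pos (H j), Finset.prod_mul_distrib]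
    simp
  · push Not at H
    obtain ⟨j, hj⟩ := H
    rw [mul_zero]
    exact Finset.prod_eq_zero (Finset.mem_univ j) (if_neg hj)

/-- The radial factor for a polynomial of degree `2 * n` on `ℂ^D`, whose real dimension is `2 * D`;
it is half of `Γ(n + D)`. -/
theorem integral_Ioi_pow_mul_exp_neg_sq (D n : ℕ) (hD : 0 < D) :
    ∫ r in Set.Ioi (0 : ℝ), r ^ (2 * D - 1) * (r ^ (2 * n) * Real.exp (-r ^ 2)) =
      (n + D - 1).factorial / 2 := by
  have h := integral_rpow_mul_exp_neg_rpow (p := 2) (q := ((2 * (n + D) - 1 : ℕ) : ℝ)) (by norm_num)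
    (by have : (0 : ℝ) ≤ ((2 * (n + D) - 1 : ℕ) : ℝ) := Nat.cast_nonneg _
        linarith)
  have e : (((2 * (n + D) - 1 : ℕ) : ℝ) + 1) / 2 = ((n + D - 1 : ℕ) : ℝ) + 1 := by
    rw [Nat.cast_sub (by omega), Nat.cast_sub (by omega)]
    push_cast
    ring
  rw [e, Real.Gamma_nat_eq_factorial] at h
  rw [div_eq_inv_mul, ← one_div, ← h]
  refine setIntegral_congr_fun measurableSet_Ioi fun r _ => ?_
  rw [Real.rpow_natCast, Real.rpow_ofNat, ← mul_assoc, ← pow_add]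
  congr 2
  omega

open Metric in
/-- The unit sphere of `ℂ^ι` carries a measure whose moments are those of the uniform measure. -/
theorem exists_measure_sphere_moments (ι : Type*) [Fintype ι] [DecidableEq ι] [Nonempty ι] :
    ∃ (ν : Measure (sphere (0 : EuclideanSpace ℂ ι) 1)) (_ : IsFiniteMeasure ν) (c : ℝ), 0 < c ∧
      ∀ (n : ℕ) (F h : Fin n → ι),
        ∫ φ, (∏ i, φ.1 (F i)) * (∏ i, starRingEnd ℂ (φ.1 (h i))) ∂ν =
          ((c / (n + Fintype.card ι - 1).factorial : ℝ) : ℂ) *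
            ∑ π : Equiv.Perm (Fin n), if F ∘ π = h then (1 : ℂ) else 0 := by
  let L := (PiLp.continuousLinearEquiv 2 ℝ (fun _ : ι => ℂ)).symm
  let μ : Measure (EuclideanSpace ℂ ι) := (volume : Measure (ι → ℂ)).map L
  have : μ.IsAddHaarMeasure := L.isAddHaarMeasure_map volume
  have hcard : 0 < Fintype.card ι := Fintype.card_pos
  have hrank : Module.finrank ℝ (EuclideanSpace ℂ ι) = 2 * Fintype.card ι := by
    rw [← L.toLinearEquiv.finrank_eq, Module.finrank_pi_fintype]
    simp [mul_comm]
  refine ⟨μ.toSphere, inferInstance, 2 * Real.pi ^ Fintype.card ι, by positivity, fun n F h => ?_⟩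
  have hmap : ∀ g : EuclideanSpace ℂ ι → ℂ, ∫ x, g x ∂μ = ∫ z, g (L z) := fun g =>
    L.toHomeomorph.measurableEmbedding.integral_map g
  -- The Gaussian integral of the monomial is known by Wick's formula and is also its sphere
  -- integral times the radial one; dividing gives the sphere moment, with `c = 2 π^D`. The measure
  -- is not normalized, as only ratios of moment constants matter in the end.
  have key := integral_homogeneous_mul_radial μ (2 * n)
    (fun x => (∏ i, x (F i)) * (∏ i, starRingEnd ℂ (x (h i)))) (fun r x _ => by
      simp [Finset.prod_mul_distrib]
      ring) (fun r => Real.exp (-r ^ 2))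
  rw [hrank, integral_Ioi_pow_mul_exp_neg_sq _ _ hcard, hmap] at key
  have hL : ∀ z j, (L z).ofLp j = z j := fun _ _ => rfl
  simp only [EuclideanSpace.norm_sq_eq, hL] at key
  rw [integral_prod_mul_conj_mul_exp F h] at key
  have hf : ((n + Fintype.card ι - 1).factorial : ℂ) ≠ 0 := by
    exact_mod_cast Nat.factorial_ne_zero _
  push_cast at key ⊢
  field_simp at key ⊢
  linear_combination -key

/-! ### The operator inequality for symmetric vectors -/

/-- The coefficient of `φ^{⊗α}` at the basis vector with index `F`. -/
def powCoeff {ι α : Type*} [Fintype α] (φ : ι → ℂ) (F : α → ι) : ℂ := ∏ i, φ (F i)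

/-- The inner product of `φ^{⊗α}` with `Ψ`. -/
def amplitude {ι α : Type*} [Fintype ι] [Fintype α] [DecidableEq α] (Ψ : (α → ι) → ℂ)
    (φ : ι → ℂ) : ℂ :=
  ∑ h, starRingEnd ℂ (powCoeff φ h) * Ψ h

theorem continuous_powCoeff {X ι α : Type*} [TopologicalSpace X] [Fintype α] {φ : X → ι → ℂ}
    (hφ : Continuous φ) (F : α → ι) : Continuous fun x => powCoeff (φ x) F := by
  unfold powCoeff
  fun_prop

theorem continuous_amplitude {X ι α : Type*} [TopologicalSpace X] [Fintype ι] [Fintype α]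
    [DecidableEq α] {φ : X → ι → ℂ} (hφ : Continuous φ) (Ψ : (α → ι) → ℂ) :
    Continuous fun x => amplitude Ψ (φ x) := by
  have := continuous_powCoeff (α := α) hφ
  unfold amplitude
  fun_prop

theorem powCoeff_sumElim {ι : Type*} {n k l : ℕ} (e : Fin k ⊕ Fin l ≃ Fin n) (φ : ι → ℂ)
    (f : Fin k → ι) (w : Fin l → ι) :
    powCoeff φ (Sum.elim f w ∘ e.symm) = powCoeff φ f * powCoeff φ w := by
  unfold powCoeff
  rw [← e.prod_comp]
  simp [Fintype.prod_sum_type]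

section Averages

variable {X : Type*} [TopologicalSpace X] [CompactSpace X] [MeasurableSpace X] [BorelSpace X]
  {ν : Measure X} [IsFiniteMeasure ν]

theorem integrable_of_continuous {f : X → ℂ} (hf : Continuous f) : Integrable f ν :=
  hf.integrable_of_hasCompactSupport (HasCompactSupport.of_compactSpace f)

/-- An average of rank one positive matrices is positive semidefinite. -/
theorem posSemidef_integral_mul_conj {κ : Type*} [Fintype κ] {v : X → κ → ℂ}
    (hv : Continuous v) :
    (Matrix.of fun f g => ∫ x, v x f * starRingEnd ℂ (v x g) ∂ν).PosSemidef := by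
  refine Matrix.PosSemidef.of_dotProduct_mulVec_nonneg ?_ fun y => ?_
  · ext f g
    rw [Matrix.conjTranspose_apply, Matrix.of_apply, Matrix.of_apply, ← starRingEnd_apply,
      ← integral_conj]
    simp [mul_comm]
  · have : star y ⬝ᵥ (Matrix.of fun f g => ∫ x, v x f * starRingEnd ℂ (v x g) ∂ν) *ᵥ y =
        ∫ x, ((‖∑ f, starRingEnd ℂ (y f) * v x f‖ ^ 2 : ℝ) : ℂ) ∂ν := by
      simp only [dotProduct, Matrix.mulVec, Matrix.of_apply, Finset.mul_sum]
      simp_rw [← integral_mul_const, ← integral_const_mul]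
      have hint : ∀ f g, Integrable (fun x => star y f *
          (v x f * starRingEnd ℂ (v x g) * y g)) ν := fun f g =>
        integrable_of_continuous (by fun_prop)
      simp_rw [← integral_finsetSum _ fun g _ => hint _ g]
      rw [← integral_finsetSum _ fun f _ => integrable_finsetSum _ fun g _ => hint f g]
      refine integral_congr_ae (.of_forall fun x => ?_)
      simp only
      rw [← Complex.normSq_eq_norm_sq, ← Complex.mul_conj, map_sum, Finset.sum_mul_sum]
      refine Finset.sum_congr rfl fun f _ => Finset.sum_congr rfl fun g _ => ?_
      simp
      ring
    rw [this, integral_complex_ofReal]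
    exact Complex.zero_le_real.mpr (integral_nonneg fun x => by positivity)

variable {ι : Type*} [Fintype ι] [DecidableEq ι] {φ : X → ι → ℂ}

/-- The operator `∫ |φ^{⊗n}⟩⟨φ^{⊗n}|` is proportional to the identity on symmetric vectors. -/
theorem integral_powCoeff_mul_amplitude (hφ : Continuous φ) {n : ℕ} {C : ℂ}
    (hmom : ∀ F h : Fin n → ι,
      ∫ x, powCoeff (φ x) F * starRingEnd ℂ (powCoeff (φ x) h) ∂ν =
        C * ∑ π : Equiv.Perm (Fin n), if F ∘ π = h then (1 : ℂ) else 0)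
    {Ψ : (Fin n → ι) → ℂ} (hΨ : ∀ (π : Equiv.Perm (Fin n)) F, Ψ (F ∘ π) = Ψ F) (F : Fin n → ι) :
    ∫ x, powCoeff (φ x) F * amplitude Ψ (φ x) ∂ν = C * n.factorial * Ψ F := by
  have hp := continuous_powCoeff (α := Fin n) hφ
  simp only [amplitude, Finset.mul_sum, ← mul_assoc]
  rw [integral_finsetSum _ fun h _ => integrable_of_continuous (by fun_prop)]
  simp_rw [integral_mul_const, hmom, mul_assoc, Finset.sum_mul]
  rw [← Finset.mul_sum, Finset.sum_comm]
  congr 1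
  simp [hΨ, Fintype.card_perm]

/-- Pairing the previous identity with `Φ`. Only `Ψ` has to be symmetric. -/
theorem integral_amplitude_mul_conj (hφ : Continuous φ) {n : ℕ} {C : ℂ}
    (hmom : ∀ F h : Fin n → ι,
      ∫ x, powCoeff (φ x) F * starRingEnd ℂ (powCoeff (φ x) h) ∂ν =
        C * ∑ π : Equiv.Perm (Fin n), if F ∘ π = h then (1 : ℂ) else 0)
    {Ψ : (Fin n → ι) → ℂ} (hΨ : ∀ (π : Equiv.Perm (Fin n)) F, Ψ (F ∘ π) = Ψ F) :
    ∀ Φ : (Fin n → ι) → ℂ, ∫ x, amplitude Ψ (φ x) * starRingEnd ℂ (amplitude Φ (φ x)) ∂ν =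
      C * n.factorial * ∑ F, Ψ F * starRingEnd ℂ (Φ F) := by
  intro Φ
  have hp := continuous_powCoeff (α := Fin n) hφ
  have ha := continuous_amplitude hφ Ψ
  have e : ∀ x, amplitude Ψ (φ x) * starRingEnd ℂ (amplitude Φ (φ x)) =
      ∑ F, powCoeff (φ x) F * amplitude Ψ (φ x) * starRingEnd ℂ (Φ F) := by
    intro x
    conv_lhs => enter [2]; rw [amplitude]
    rw [map_sum, Finset.mul_sum]
    refine Finset.sum_congr rfl fun F _ => ?_
    rw [map_mul, Complex.conj_conj]
    ring
  simp_rw [e]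
  rw [integral_finsetSum _ fun h _ => integrable_of_continuous (by fun_prop), Finset.mul_sum]
  refine Finset.sum_congr rfl fun F _ => ?_
  rw [integral_mul_const, integral_powCoeff_mul_amplitude hφ hmom hΨ, mul_assoc]

/-- The operator inequality behind the de Finetti theorem for symmetric pure states: with the
moment constants `K_n` and `K_l` of `n` and of `l = n - k` factors,
`(K_l - 2 K_n) ξ + ∫ |φ^{⊗k}⟩⟨φ^{⊗k}| |⟨φ^{⊗n}, Ψ⟩|²` is positive semidefinite, where `ξ` is the
reduced state of `Ψ` on `k` factors. -/
theorem posSemidef_deFinetti (hφ : Continuous φ) {n k l : ℕ} (e : Fin k ⊕ Fin l ≃ Fin n)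
    {Cn Cl : ℝ}
    (hn : ∀ F h : Fin n → ι,
      ∫ x, powCoeff (φ x) F * starRingEnd ℂ (powCoeff (φ x) h) ∂ν =
        Cn * ∑ π : Equiv.Perm (Fin n), if F ∘ π = h then (1 : ℂ) else 0)
    (hl : ∀ F h : Fin l → ι,
      ∫ x, powCoeff (φ x) F * starRingEnd ℂ (powCoeff (φ x) h) ∂ν =
        Cl * ∑ π : Equiv.Perm (Fin l), if F ∘ π = h then (1 : ℂ) else 0)
    {Ψ : (Fin n → ι) → ℂ} (hΨ : ∀ (π : Equiv.Perm (Fin n)) F, Ψ (F ∘ π) = Ψ F) :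
    (Matrix.of fun f g : Fin k → ι =>
      ((Cl * l.factorial - 2 * (Cn * n.factorial) : ℝ) : ℂ) *
        (∑ w, Ψ (Sum.elim f w ∘ e.symm) * starRingEnd ℂ (Ψ (Sum.elim g w ∘ e.symm))) +
      ∫ x, powCoeff (φ x) f * starRingEnd ℂ (powCoeff (φ x) g) *
        (amplitude Ψ (φ x) * starRingEnd ℂ (amplitude Ψ (φ x))) ∂ν).PosSemidef := by
  let Ψf : (Fin k → ι) → (Fin l → ι) → ℂ := fun f w => Ψ (Sum.elim f w ∘ e.symm)
  have hΨf : ∀ f (π : Equiv.Perm (Fin l)) w, Ψf f (w ∘ π) = Ψf f w := by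
    intro f π w
    have : Sum.elim f (w ∘ π) ∘ e.symm = (Sum.elim f w ∘ e.symm) ∘
        ((e.symm.trans (Equiv.sumCongr (Equiv.refl _) π)).trans e) := by
      funext i
      obtain ⟨i, rfl⟩ := e.surjective i
      rcases i with i | i <;> simp
    simp only [Ψf, this, hΨ]
  have hpk := continuous_powCoeff (α := Fin k) hφ
  have hpl := continuous_powCoeff (α := Fin l) hφ
  have hA := continuous_amplitude hφ Ψ
  have ha := fun f => continuous_amplitude hφ (Ψf f)
  -- Since `φ^{⊗k} ⊗ φ^{⊗l} = φ^{⊗n}`, the cross term involves the moment operator of all `n`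
  -- factors, hence the constant of `n` rather than of `l`.
  have hcross : ∀ f g, ∫ x, powCoeff (φ x) f * amplitude Ψ (φ x) *
      starRingEnd ℂ (amplitude (Ψf g) (φ x)) ∂ν =
      Cn * n.factorial * ∑ w, Ψf f w * starRingEnd ℂ (Ψf g w) := by
    intro f g
    have e1 : ∀ x, powCoeff (φ x) f * amplitude Ψ (φ x) *
        starRingEnd ℂ (amplitude (Ψf g) (φ x)) =
        ∑ w, powCoeff (φ x) (Sum.elim f w ∘ e.symm) * amplitude Ψ (φ x) *
          starRingEnd ℂ (Ψf g w) := by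
      intro x
      conv_lhs => enter [2]; rw [amplitude]
      rw [map_sum, Finset.mul_sum]
      refine Finset.sum_congr rfl fun F _ => ?_
      rw [map_mul, Complex.conj_conj, powCoeff_sumElim]
      ring
    simp_rw [e1, powCoeff_sumElim]
    rw [integral_finsetSum _ fun h _ => integrable_of_continuous (by fun_prop), Finset.mul_sum]
    refine Finset.sum_congr rfl fun w _ => ?_
    simp_rw [← powCoeff_sumElim e]
    rw [integral_mul_const, integral_powCoeff_mul_amplitude hφ hn hΨ, mul_assoc]
  -- For fixed `x`, `amplitude (Ψf f) (φ x)` is the coefficient at `f` of `⟨φ^{⊗l}, Ψ⟩`. Subtracting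
  -- `φ^{⊗k} ⟨φ^{⊗n}, Ψ⟩` and expanding the square gives one term with the constant of `l`, two
  -- conjugate cross terms, and the integral in the statement.
  convert posSemidef_integral_mul_conj (ν := ν)
    (v := fun x f => amplitude (Ψf f) (φ x) - powCoeff (φ x) f * amplitude Ψ (φ x))
    (by fun_prop) using 1
  ext f g
  simp only [Matrix.of_apply]
  have e2 : ∀ x, (amplitude (Ψf f) (φ x) - powCoeff (φ x) f * amplitude Ψ (φ x)) *
      starRingEnd ℂ (amplitude (Ψf g) (φ x) - powCoeff (φ x) g * amplitude Ψ (φ x)) =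
      (amplitude (Ψf f) (φ x) * starRingEnd ℂ (amplitude (Ψf g) (φ x)) -
      powCoeff (φ x) f * amplitude Ψ (φ x) * starRingEnd ℂ (amplitude (Ψf g) (φ x)) -
      starRingEnd ℂ (powCoeff (φ x) g * amplitude Ψ (φ x) *
        starRingEnd ℂ (amplitude (Ψf f) (φ x)))) +
      powCoeff (φ x) f * starRingEnd ℂ (powCoeff (φ x) g) *
        (amplitude Ψ (φ x) * starRingEnd ℂ (amplitude Ψ (φ x))) := by
    intro x
    simp only [map_sub, map_mul, Complex.conj_conj]
    ring
  simp_rw [e2]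
  rw [integral_add, integral_sub, integral_sub, integral_conj, hcross, hcross,
    integral_amplitude_mul_conj hφ hl (hΨf f)]
  · congr 1
    simp only [map_mul, map_sum, Complex.conj_conj, Complex.conj_ofReal, map_natCast, Ψf]
    simp_rw [fun w => mul_comm (starRingEnd ℂ (Ψ (Sum.elim g w ∘ e.symm)))]
    push_cast
    ring
  all_goals exact integrable_of_continuous (by fun_prop)

end Averages

/-! ### Purification and partial traces -/

/-- The density matrix on `ℂ^d` obtained by tracing out the second factor of a unit vector. -/
def reducedMatrix {d : ℕ} (φ : Fin d × Fin d → ℂ) : Matrix (Fin d) (Fin d) ℂ :=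
  Matrix.of fun a b => ∑ u, φ (a, u) * starRingEnd ℂ (φ (b, u))

theorem isDensity_reducedMatrix {d : ℕ} {φ : Fin d × Fin d → ℂ} (hφ : ∑ j, ‖φ j‖ ^ 2 = 1) :
    IsDensity (reducedMatrix φ) := by
  refine ⟨?_, ?_⟩
  · convert Matrix.posSemidef_self_mul_conjTranspose (Matrix.of fun a u => φ (a, u)) using 1
    ext a b
    simp [reducedMatrix, Matrix.mul_apply]
  · simp only [Matrix.trace, reducedMatrix, Matrix.diag_apply, Matrix.of_apply]
    rw [← Fintype.sum_prod_type' (fun a u => φ (a, u) * starRingEnd ℂ (φ (a, u)))]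
    simp_rw [Complex.mul_conj, Complex.normSq_eq_norm_sq]
    exact_mod_cast hφ

/-- The square root of a permutation-invariant operator is permutation-invariant. -/
theorem sqrt_comp_perm {d n : ℕ} {ξ : TensorOp d n} (hξ : ξ.PosSemidef)
    (hsymm : IsPermInvariant ξ) (π : Equiv.Perm (Fin n)) (f g : Fin n → Fin d) :
    CFC.sqrt ξ (f ∘ π) (g ∘ π) = CFC.sqrt ξ f g := by
  have hconj : ∀ (A : TensorOp d n) f g, (permOp d π * A * (permOp d π)ᴴ) f g =
      A (f ∘ π) (g ∘ π) := by
    intro A f g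
    have hiff : ∀ f g : Fin n → Fin d, f = g ∘ ⇑π⁻¹ ↔ g = f ∘ π := by
      intro f g
      constructor
      · rintro rfl
        funext i
        simp
      · rintro rfl
        funext i
        simp
    simp only [Matrix.mul_apply, permOp, Matrix.conjTranspose_apply, Matrix.of_apply, hiff]
    simp [apply_ite star]
  have hnn : (0 : TensorOp d n) ≤ CFC.sqrt ξ := CFC.sqrt_nonneg ξ
  have hsq : CFC.sqrt ξ * CFC.sqrt ξ = ξ := CFC.sqrt_mul_sqrt_self ξ hξ.nonneg
  -- The conjugate of `CFC.sqrt ξ` by `π` is again positive and squares to `π ξ π† = ξ`, so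
  -- uniqueness of the positive square root applies.
  have key : CFC.sqrt ξ = permOp d π * CFC.sqrt ξ * (permOp d π)ᴴ := by
    refine CFC.sqrt_unique ?_ ?_
    · conv_rhs => rw [← hsymm π, ← hsq]
      ext f g
      rw [hconj, Matrix.mul_apply, Matrix.mul_apply]
      simp_rw [hconj]
      exact (π.symm.arrowCongr (Equiv.refl _)).sum_comp
        fun h : Fin n → Fin d => CFC.sqrt ξ (f ∘ π) h * CFC.sqrt ξ h (g ∘ π)
    · exact ((Matrix.nonneg_iff_posSemidef.mp hnn).mul_mul_conjTranspose_same _).nonneg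
  conv_rhs => rw [key, hconj]

/-- The amplitude of the canonical purification of `ξ`. -/
def purification {d n : ℕ} (ξ : TensorOp d n) (F : Fin n → Fin d × Fin d) : ℂ :=
  CFC.sqrt ξ (Prod.fst ∘ F) (Prod.snd ∘ F)

/-- The square root is hermitian, so the sum is an entry of its square: tracing out the purifying
factors recovers `ξ`. -/
theorem sum_purification {d n : ℕ} {ξ : TensorOp d n} (hξ : ξ.PosSemidef) (f g : Fin n → Fin d) :
    ∑ u : Fin n → Fin d, purification ξ (fun i => (f i, u i)) *
      starRingEnd ℂ (purification ξ fun i => (g i, u i)) = ξ f g := by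
  have hnn : (0 : TensorOp d n) ≤ CFC.sqrt ξ := CFC.sqrt_nonneg ξ
  have hH : (CFC.sqrt ξ)ᴴ = CFC.sqrt ξ := (Matrix.nonneg_iff_posSemidef.mp hnn).1
  conv_rhs => rw [← CFC.sqrt_mul_sqrt_self ξ hξ.nonneg, Matrix.mul_apply]
  refine Finset.sum_congr rfl fun u _ => ?_
  conv_rhs => enter [2]; rw [← hH, Matrix.conjTranspose_apply]
  rfl

/-- Splitting `n` tensor factors into the first `k` and the last `n - k`. -/
def splitEquiv {n k : ℕ} (hk : k ≤ n) : Fin k ⊕ Fin (n - k) ≃ Fin n :=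
  finSumFinEquiv.trans (finCongr (Nat.add_sub_of_le hk))

theorem joinIndex_eq {d n k : ℕ} (hk : k ≤ n) (f : Fin k → Fin d) (w : Fin (n - k) → Fin d) :
    joinIndex hk f w = Sum.elim f w ∘ (splitEquiv hk).symm := by
  funext i
  obtain ⟨i, rfl⟩ := (splitEquiv hk).surjective i
  rw [Function.comp_apply, Equiv.symm_apply_apply]
  rcases i with i | i <;> simp [joinIndex, splitEquiv]

theorem sum_joinIndex {d n k : ℕ} (hk : k ≤ n) {M : Type*} [AddCommMonoid M]
    (G : (Fin n → Fin d) → M) : ∑ f, ∑ w, G (joinIndex hk f w) = ∑ F, G F := by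
  simp_rw [joinIndex_eq]
  rw [← Fintype.sum_prod_type' (fun f w => G (Sum.elim f w ∘ (splitEquiv hk).symm))]
  exact (((Equiv.sumArrowEquivProdArrow _ _ _).symm.trans
    ((splitEquiv hk).arrowCongr (Equiv.refl _)))).sum_comp G

theorem posSemidef_partialTrace {d n k : ℕ} (hk : k ≤ n) {ξ : TensorOp d n}
    (hξ : ξ.PosSemidef) : (partialTrace hk ξ).PosSemidef := by
  have : partialTrace hk ξ =
      ∑ w, ξ.submatrix (fun f => joinIndex hk f w) fun f => joinIndex hk f w := by
    ext f g
    simp [partialTrace, Matrix.sum_apply]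
  rw [this]
  exact Matrix.posSemidef_sum _ fun w _ => hξ.submatrix _

theorem trace_partialTrace {d n k : ℕ} (hk : k ≤ n) (ξ : TensorOp d n) :
    (partialTrace hk ξ).trace = ξ.trace :=
  sum_joinIndex hk fun F => ξ F F

/-- The partial trace over the last factors and over the purifying system. -/
theorem sum_purification_join {d n k : ℕ} (hk : k ≤ n) {ξ : TensorOp d n} (hξ : ξ.PosSemidef)
    (f g : Fin k → Fin d) :
    ∑ u : Fin k → Fin d, ∑ w : Fin (n - k) → Fin d × Fin d,
      purification ξ (Sum.elim (fun i => (f i, u i)) w ∘ (splitEquiv hk).symm) *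
        starRingEnd ℂ (purification ξ (Sum.elim (fun i => (g i, u i)) w ∘ (splitEquiv hk).symm)) =
      partialTrace hk ξ f g := by
  have hsplit : ∀ (f u : Fin k → Fin d) (w v : Fin (n - k) → Fin d),
      Sum.elim (fun i => (f i, u i)) (fun i => (w i, v i)) ∘ (splitEquiv hk).symm =
        fun i => (joinIndex hk f w i, joinIndex hk u v i) := by
    intro f u w v
    simp_rw [joinIndex_eq]
    funext i
    obtain ⟨i, rfl⟩ := (splitEquiv hk).surjective i
    rcases i with i | i <;> simp
  simp only [partialTrace, Matrix.of_apply, ← sum_purification hξ]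
  rw [Finset.sum_comm' (t' := Finset.univ) (s' := fun _ => Finset.univ) (by simp)]
  rw [← (Equiv.arrowProdEquivProdArrow _ _ _).symm.sum_comp, Fintype.sum_prod_type]
  refine Finset.sum_congr rfl fun w _ => ?_
  rw [Finset.sum_comm, ← sum_joinIndex hk]
  refine Finset.sum_congr rfl fun u _ => Finset.sum_congr rfl fun v _ => ?_
  rw [← hsplit, ← hsplit]
  rfl

/-- By distributivity, tracing out the second factors of `φ^{⊗k}` acts factor by factor. This turns
pure product vectors into powers of mixed states. -/
theorem sum_powCoeff_mul_conj {d k : ℕ} (φ : Fin d × Fin d → ℂ) (f g : Fin k → Fin d) :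
    ∑ u : Fin k → Fin d, powCoeff φ (fun i => (f i, u i)) *
      starRingEnd ℂ (powCoeff φ fun i => (g i, u i)) = tensorPow k (reducedMatrix φ) f g := by
  simp only [tensorPow, reducedMatrix, Matrix.of_apply, Finset.prod_univ_sum, powCoeff, map_prod,
    ← Finset.prod_mul_distrib, Fintype.piFinset_univ]

/-! ### The ratio of symmetric dimensions -/

/-- The ratio of the dimensions of the symmetric subspaces of `l` and `n` factors. -/
theorem one_sub_dim_ratio_le (D : ℕ) (hD : 0 < D) {l n : ℕ} (hn : 0 < n) (hl : l ≤ n) :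
    ((n.factorial : ℝ) / (n + D - 1).factorial) / ((l.factorial : ℝ) / (l + D - 1).factorial) ≤ 1 ∧
    1 - ((n.factorial : ℝ) / (n + D - 1).factorial) /
      ((l.factorial : ℝ) / (l + D - 1).factorial) ≤ D * (n - l : ℕ) / n := by
  have hn' : (0 : ℝ) < n := by exact_mod_cast hn
  rw [Nat.cast_sub hl]
  have hl' : (l : ℝ) ≤ n := by exact_mod_cast hl
  have hl0 : (0 : ℝ) ≤ l := by positivity
  -- The ratio is the product of `(l + j) / (n + j)` over `1 ≤ j ≤ D - 1`, handled one factor at a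
  -- time. For `D = 1` the product is empty, so the bound with `D` in place of `D - 1` has some
  -- slack.
  obtain ⟨m, rfl⟩ : ∃ m, D = m + 1 := ⟨D - 1, by omega⟩
  induction m with
  | zero =>
    simp only [zero_add, Nat.add_sub_cancel]
    rw [div_self (by positivity), div_self (by positivity)]
    refine ⟨by norm_num, ?_⟩
    have : (0 : ℝ) ≤ n - l := by linarith
    norm_num
    positivity
  | succ m ih =>
    obtain ⟨h1, h2⟩ := ih (by omega)
    rw [show n + (m + 1) - 1 = n + m by omega, show l + (m + 1) - 1 = l + m by omega] at h1 h2
    rw [show n + (m + 1 + 1) - 1 = n + m + 1 by omega,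
      show l + (m + 1 + 1) - 1 = l + m + 1 by omega, Nat.factorial_succ, Nat.factorial_succ]
    set s : ℝ := ((n.factorial : ℝ) / (n + m).factorial) / ((l.factorial : ℝ) / (l + m).factorial)
      with hs
    have hs0 : 0 ≤ s := by positivity
    have hm : (0 : ℝ) ≤ m := by positivity
    have e : ((n.factorial : ℝ) / ((n + m + 1) * (n + m).factorial : ℕ)) /
        ((l.factorial : ℝ) / ((l + m + 1) * (l + m).factorial : ℕ)) =
        s * ((l + m + 1) / (n + m + 1)) := by
      rw [hs]
      push_cast
      field_simp
    rw [e]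
    have hr1 : ((l : ℝ) + m + 1) / (n + m + 1) ≤ 1 := by
      rw [div_le_one (by positivity)]
      linarith
    refine ⟨mul_le_one₀ h1 (by positivity) hr1, ?_⟩
    have hr2 : 1 - ((l : ℝ) + m + 1) / (n + m + 1) ≤ (n - l) / n := by
      rw [one_sub_div (by positivity)]
      have : (n : ℝ) + m + 1 - (l + m + 1) = n - l := by ring
      rw [this]
      exact div_le_div_of_nonneg_left (by linarith) hn' (by linarith)
    -- With `r` the new factor, `1 - s r = (1 - s) + s (1 - r) ≤ (1 - s) + (1 - r)`: the deficits
    -- add up.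
    have hr3 : s * (1 - ((l : ℝ) + m + 1) / (n + m + 1)) ≤
        1 - ((l : ℝ) + m + 1) / (n + m + 1) := mul_le_of_le_one_left (by linarith) h1
    have e2 : (((m + 1 + 1 : ℕ) : ℝ)) * (n - l) / n =
        ((m + 1 : ℕ) : ℝ) * (n - l) / n + (n - l) / n := by
      push_cast
      ring
    rw [e2]
    nlinarith

/-! ### The approximating mixture and the reduced inequality -/

/-- The mixture of the product states `σ_φ^{⊗k}`, with `φ` distributed according to the squared
amplitude of a vector `Ψ`. -/
theorem exists_productMixture {d n : ℕ} {X : Type*} [TopologicalSpace X] [CompactSpace X]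
    [MeasurableSpace X] [BorelSpace X] {ν : Measure X} [IsFiniteMeasure ν]
    {φ : X → Fin d × Fin d → ℂ} (hφ : Continuous φ) (hφ1 : ∀ x, ∑ j, ‖φ x j‖ ^ 2 = 1)
    (Ψ : (Fin n → Fin d × Fin d) → ℂ) {K : ℝ} (hK : 0 < K)
    (hΨ : ∫ x, amplitude Ψ (φ x) * starRingEnd ℂ (amplitude Ψ (φ x)) ∂ν = K) (k : ℕ) :
    ∃ τ ∈ productMixtures d k, ∀ f g, (K : ℂ) * τ f g =
      ∫ x, tensorPow k (reducedMatrix (φ x)) f g *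
        (amplitude Ψ (φ x) * starRingEnd ℂ (amplitude Ψ (φ x))) ∂ν := by
  let σ : X → State d := fun x => ⟨reducedMatrix (φ x), isDensity_reducedMatrix (hφ1 x)⟩
  have hσ : Continuous σ := by
    refine Continuous.subtype_mk ?_ _
    refine continuous_matrix fun a b => ?_
    simp only [reducedMatrix, Matrix.of_apply]
    fun_prop
  have hA := continuous_amplitude hφ Ψ
  -- `K` is the total mass of the squared amplitude, so `w` is a probability density; the mixing
  -- measure is the image of `w ν` under `σ`.
  let w : X → ℝ := fun x => ‖amplitude Ψ (φ x)‖ ^ 2 / K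
  have hw : Continuous w := by fun_prop
  have hw0 : ∀ x, 0 ≤ w x := fun x => by positivity
  have hwA : ∀ x, amplitude Ψ (φ x) * starRingEnd ℂ (amplitude Ψ (φ x)) = K * (w x : ℂ) := by
    intro x
    have : (K : ℂ) ≠ 0 := by exact_mod_cast hK.ne'
    rw [Complex.mul_conj, Complex.normSq_eq_norm_sq]
    simp only [w]
    push_cast
    field_simp
  have hKc : (K : ℂ) ≠ 0 := by exact_mod_cast hK.ne'
  have hw1 : ∫ x, w x ∂ν = 1 := by
    simp_rw [hwA] at hΨ
    rw [integral_const_mul, integral_complex_ofReal] at hΨ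
    exact_mod_cast mul_left_cancel₀ hKc (hΨ.trans (mul_one _).symm)
  have hwi : Integrable w ν :=
    hw.integrable_of_hasCompactSupport (HasCompactSupport.of_compactSpace w)
  let m₀ : Measure X := ν.withDensity fun x => ENNReal.ofReal (w x)
  have hm₀ : IsProbabilityMeasure m₀ := by
    refine ⟨?_⟩
    rw [withDensity_apply _ .univ, setLIntegral_univ,
      ← ofReal_integral_eq_lintegral_ofReal hwi (.of_forall hw0), hw1, ENNReal.ofReal_one]
  refine ⟨mixture k (m₀.map σ),
    ⟨_, Measure.isProbabilityMeasure_map hσ.measurable.aemeasurable, rfl⟩, fun f g => ?_⟩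
  have htp : Continuous fun ρ : State d => tensorPow k ρ.1 f g := by
    have hv : Continuous fun ρ : State d => ρ.1 := continuous_subtype_val
    simp only [tensorPow, Matrix.of_apply]
    exact continuous_finsetProd _ fun i _ => hv.matrix_elem _ _
  simp only [mixture, Matrix.of_apply]
  rw [integral_map hσ.measurable.aemeasurable htp.measurable.aestronglyMeasurable,
    integral_withDensity_eq_integral_toReal_smul (by fun_prop) (.of_forall fun x => by simp),
    ← integral_const_mul]
  refine integral_congr_ae (.of_forall fun x => ?_)
  simp only
  rw [hwA, ENNReal.toReal_ofReal (hw0 x), Complex.real_smul]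
  ring

theorem trace_tensorPow {d : ℕ} (k : ℕ) (σ : Matrix (Fin d) (Fin d) ℂ) :
    (tensorPow k σ).trace = σ.trace ^ k := by
  simp only [Matrix.trace, Matrix.diag_apply, tensorPow, Matrix.of_apply]
  rw [← Fin.prod_const, Finset.prod_univ_sum, Fintype.piFinset_univ]

theorem continuous_tensorPow_reducedMatrix {d k : ℕ} {X : Type*} [TopologicalSpace X]
    {φ : X → Fin d × Fin d → ℂ} (hφ : Continuous φ) (f g : Fin k → Fin d) :
    Continuous fun x => tensorPow k (reducedMatrix (φ x)) f g := by
  simp only [tensorPow, reducedMatrix, Matrix.of_apply]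
  fun_prop

section Reduction

variable {X : Type*} [TopologicalSpace X] [CompactSpace X] [MeasurableSpace X] [BorelSpace X]
  {ν : Measure X} [IsFiniteMeasure ν] {d k : ℕ} {φ : X → Fin d × Fin d → ℂ}

theorem integral_tensorPow_eq_sum (hφ : Continuous φ) {A : X → ℂ} (hA : Continuous A)
    (f g : Fin k → Fin d) :
    ∫ x, tensorPow k (reducedMatrix (φ x)) f g * (A x * starRingEnd ℂ (A x)) ∂ν =
      ∑ u : Fin k → Fin d, ∫ x, powCoeff (φ x) (fun i => (f i, u i)) *
        starRingEnd ℂ (powCoeff (φ x) fun i => (g i, u i)) * (A x * starRingEnd ℂ (A x)) ∂ν := by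
  have hp := continuous_powCoeff (α := Fin k) hφ
  rw [← integral_finsetSum _ fun u _ => integrable_of_continuous (by fun_prop)]
  simp_rw [← Finset.sum_mul, sum_powCoeff_mul_conj]

theorem posSemidef_integral_tensorPow (hφ : Continuous φ) {A : X → ℂ} (hA : Continuous A) :
    (Matrix.of fun f g => ∫ x, tensorPow k (reducedMatrix (φ x)) f g *
      (A x * starRingEnd ℂ (A x)) ∂ν).PosSemidef := by
  have hp := continuous_powCoeff (α := Fin k) hφ
  have h2 := Matrix.posSemidef_sum Finset.univ fun (u : Fin k → Fin d) _ =>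
    posSemidef_integral_mul_conj (ν := ν)
      (v := fun x (f : Fin k → Fin d) => powCoeff (φ x) (fun i => (f i, u i)) * A x) (by fun_prop)
  convert h2 using 1
  ext f g
  rw [Matrix.of_apply, integral_tensorPow_eq_sum hφ hA, Matrix.sum_apply]
  refine Finset.sum_congr rfl fun u _ => integral_congr_ae (.of_forall fun x => ?_)
  simp only [map_mul]
  ring

/-- The operator inequality for the purification, traced over the purifying system. -/
theorem posSemidef_partialTrace_add_integral (hφ : Continuous φ) {n : ℕ} (hk : k ≤ n)
    {ξ : TensorOp d n} (hξ : ξ.PosSemidef)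
    (hΨ : ∀ (π : Equiv.Perm (Fin n)) F, purification ξ (F ∘ π) = purification ξ F) {Cn Cl : ℝ}
    (hn : ∀ F h : Fin n → Fin d × Fin d,
      ∫ x, powCoeff (φ x) F * starRingEnd ℂ (powCoeff (φ x) h) ∂ν =
        Cn * ∑ π : Equiv.Perm (Fin n), if F ∘ π = h then (1 : ℂ) else 0)
    (hl : ∀ F h : Fin (n - k) → Fin d × Fin d,
      ∫ x, powCoeff (φ x) F * starRingEnd ℂ (powCoeff (φ x) h) ∂ν =
        Cl * ∑ π : Equiv.Perm (Fin (n - k)), if F ∘ π = h then (1 : ℂ) else 0) :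
    (((Cl * (n - k).factorial - 2 * (Cn * n.factorial) : ℝ) : ℂ) • partialTrace hk ξ +
      Matrix.of fun f g => ∫ x, tensorPow k (reducedMatrix (φ x)) f g *
        (amplitude (purification ξ) (φ x) *
          starRingEnd ℂ (amplitude (purification ξ) (φ x))) ∂ν).PosSemidef := by
  have h := posSemidef_deFinetti hφ (splitEquiv hk) hn hl hΨ
  -- The partial trace over the purifying parts of the first `k` factors is a sum of principal
  -- submatrices, one for each index `u`, so it preserves positivity.
  have h2 := Matrix.posSemidef_sum Finset.univ fun (u : Fin k → Fin d) _ =>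
    h.submatrix fun (f : Fin k → Fin d) i => (f i, u i)
  convert h2 using 1
  ext f g
  rw [Matrix.add_apply, Matrix.smul_apply, smul_eq_mul, Matrix.of_apply,
    integral_tensorPow_eq_sum hφ (continuous_amplitude hφ _), Matrix.sum_apply,
    ← sum_purification_join hk hξ, Finset.mul_sum, ← Finset.sum_add_distrib]
  rfl

end Reduction

/-! ### The trace distance bound -/

theorem traceDist_partialTrace_le {d n k : ℕ} (hn : 0 < n) (hk : k ≤ n) {ξ : TensorOp d n}
    (hξ : IsDensity ξ) (hsymm : IsPermInvariant ξ) :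
    ∃ τ ∈ productMixtures d k,
      traceDist (partialTrace hk ξ) τ ≤ 2 * ((d : ℝ) ^ 2 * (k : ℝ) / (n : ℝ)) := by
  -- For `d = 0` and `n ≥ 1` the space is zero and carries no operator of trace one.
  have hd : 0 < d := by
    rcases Nat.eq_zero_or_pos d with rfl | h
    · have : IsEmpty (Fin n → Fin 0) := ⟨fun f => (f ⟨0, hn⟩).elim0⟩
      have := hξ.2
      simp [Matrix.trace] at this
    · exact h
  have : Nonempty (Fin d × Fin d) := ⟨(⟨0, hd⟩, ⟨0, hd⟩)⟩
  obtain ⟨ν, _, c, hc, hmom⟩ := exists_measure_sphere_moments (Fin d × Fin d)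
  rw [Fintype.card_prod, Fintype.card_fin] at hmom
  let φ : Metric.sphere (0 : EuclideanSpace ℂ (Fin d × Fin d)) 1 → Fin d × Fin d → ℂ :=
    fun x => x.1.ofLp
  have hφ : Continuous φ := (PiLp.continuous_ofLp 2 _).comp continuous_subtype_val
  have hφ1 : ∀ x, ∑ j, ‖φ x j‖ ^ 2 = 1 := by
    intro x
    have := EuclideanSpace.norm_sq_eq x.1
    rw [mem_sphere_zero_iff_norm.mp x.2, one_pow] at this
    exact this.symm
  have hmom' : ∀ (m : ℕ) (F h : Fin m → Fin d × Fin d),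
      ∫ x, powCoeff (φ x) F * starRingEnd ℂ (powCoeff (φ x) h) ∂ν =
        ((c / (m + d * d - 1).factorial : ℝ) : ℂ) *
          ∑ π : Equiv.Perm (Fin m), if F ∘ π = h then (1 : ℂ) else 0 := by
    intro m F h
    rw [← hmom m F h]
    simp only [powCoeff, map_prod]
    rfl
  have hΨ : ∀ (π : Equiv.Perm (Fin n)) F, purification ξ (F ∘ π) = purification ξ F :=
    fun π F => sqrt_comp_perm hξ.1 hsymm π (Prod.fst ∘ F) (Prod.snd ∘ F)
  -- The scalar by which the `m`-fold moment operator acts on symmetric vectors: the factor `m!` is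
  -- the number of permutations in the moment formula.
  set K : ℕ → ℝ := fun m => c / (m + d * d - 1).factorial * m.factorial with hKdef
  have hK : ∀ m, 0 < K m := fun m => by positivity
  have hnorm : ∑ F, purification ξ F * starRingEnd ℂ (purification ξ F) = 1 := by
    rw [← hξ.2, Matrix.trace, ← (Equiv.arrowProdEquivProdArrow _ _ _).symm.sum_comp,
      Fintype.sum_prod_type]
    exact Finset.sum_congr rfl fun f _ => sum_purification hξ.1 f f
  have hamp := integral_amplitude_mul_conj hφ (hmom' n) hΨ (purification ξ)
  rw [hnorm, mul_one] at hamp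
  obtain ⟨τ, hτmem, hτ⟩ := exists_productMixture hφ hφ1 (purification ξ) (hK n)
    (by rw [hamp, hKdef]; push_cast; rfl) k
  refine ⟨τ, hτmem, ?_⟩
  have hA := continuous_amplitude hφ (purification ξ)
  have ht := continuous_tensorPow_reducedMatrix (k := k) hφ
  have hKτ : (K n : ℂ) • τ = Matrix.of fun f g => ∫ x, tensorPow k (reducedMatrix (φ x)) f g *
      (amplitude (purification ξ) (φ x) *
        starRingEnd ℂ (amplitude (purification ξ) (φ x))) ∂ν := by
    ext f g
    exact hτ f g
  have hτpos : ((K n : ℂ) • τ).PosSemidef := by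
    rw [hKτ]
    exact posSemidef_integral_tensorPow hφ hA
  have hQ : (((K (n - k) - 2 * K n : ℝ) : ℂ) • partialTrace hk ξ + (K n : ℂ) • τ).PosSemidef := by
    rw [hKτ]
    exact posSemidef_partialTrace_add_integral hφ hk hξ.1 hΨ (hmom' n) (hmom' (n - k))
  have htrξ : (partialTrace hk ξ).trace = 1 := (trace_partialTrace hk ξ).trans hξ.2
  have htrτ : τ.trace = 1 := by
    have hKc : (K n : ℂ) ≠ 0 := by exact_mod_cast (hK n).ne'
    refine mul_left_cancel₀ hKc ?_
    rw [Matrix.trace, Finset.mul_sum]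
    simp only [Matrix.diag_apply, hτ]
    rw [← integral_finsetSum _ fun f _ => integrable_of_continuous (by fun_prop)]
    have e : ∀ x, ∑ f, tensorPow k (reducedMatrix (φ x)) f f *
        (amplitude (purification ξ) (φ x) * starRingEnd ℂ (amplitude (purification ξ) (φ x))) =
        amplitude (purification ξ) (φ x) *
          starRingEnd ℂ (amplitude (purification ξ) (φ x)) := by
      intro x
      rw [← Finset.sum_mul]
      have := trace_tensorPow k (reducedMatrix (φ x))
      rw [(isDensity_reducedMatrix (hφ1 x)).2, one_pow] at this
      rw [show (∑ f, tensorPow k (reducedMatrix (φ x)) f f) = 1 from this, one_mul]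
    simp_rw [e]
    rw [hamp, mul_one, hKdef]
    push_cast
    rfl
  set s := K n / K (n - k) with hs
  have hratio : s ≤ 1 ∧ 1 - s ≤ (d : ℝ) ^ 2 * k / n := by
    have h := one_sub_dim_ratio_le (d * d) (by positivity) hn (Nat.sub_le n k)
    have e : s = ((n.factorial : ℝ) / (n + d * d - 1).factorial) /
        (((n - k).factorial : ℝ) / (n - k + d * d - 1).factorial) := by
      rw [hs, hKdef]
      field_simp
    rw [← e, Nat.sub_sub_self hk] at h
    convert h using 3
    push_cast
    ring
  have hs0 : 0 < s := by positivity
  have hKl := hK (n - k)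
  have hsK : K n = s * K (n - k) := by rw [hs, div_mul_cancel₀ _ hKl.ne']
  have hKlc : (K (n - k) : ℂ) ≠ 0 := by exact_mod_cast hKl.ne'
  have hτp : τ.PosSemidef := by
    have := hτpos.smul (a := ((K n)⁻¹ : ℝ)) (by have := hK n; positivity)
    convert this using 1
    ext f g
    have : (K n : ℂ) ≠ 0 := by exact_mod_cast (hK n).ne'
    simp [this]
  have hB : (((1 - 2 * s : ℝ) : ℂ) • partialTrace hk ξ + (s : ℂ) • τ).PosSemidef := by
    have := hQ.smul (a := ((K (n - k))⁻¹ : ℝ)) (by positivity)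
    convert this using 1
    ext f g
    simp only [Matrix.add_apply, Matrix.smul_apply, smul_eq_mul, hsK, Complex.real_smul]
    push_cast
    field_simp
  have hδ : (0 : ℝ) ≤ 1 - s := by linarith [hratio.1]
  have hP : (((2 * (1 - s) : ℝ)) • partialTrace hk ξ).PosSemidef :=
    (posSemidef_partialTrace hk hξ.1).smul (by linarith)
  have hN := hB.add (hτp.smul hδ)
  -- The subtracted operator is the positive combination of `hB` plus `(1 - s) τ`. Its trace is `(1
  -- - 2s) + s + (1 - s) = 2 (1 - s)`, so the trace norm is at most `4 (1 - s)`.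
  have hdiff : partialTrace hk ξ - τ = ((2 * (1 - s) : ℝ)) • partialTrace hk ξ -
      ((((1 - 2 * s : ℝ) : ℂ) • partialTrace hk ξ + (s : ℂ) • τ) + (1 - s) • τ) := by
    ext f g
    simp only [Matrix.sub_apply, Matrix.add_apply, Matrix.smul_apply, smul_eq_mul,
      Complex.real_smul]
    push_cast
    ring
  have hfin := trace_abs_sub_le hP hN
  rw [← hdiff] at hfin
  simp only [Matrix.trace_add, Matrix.trace_smul, htrξ, htrτ, smul_eq_mul, Complex.real_smul,
    mul_one, Complex.add_re, Complex.ofReal_re] at hfin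
  rw [traceDist]
  linarith [hratio.2]

end DeFinetti

end

theorem mainTheorem3 (d n k : ℕ) (hn : 0 < n) (hk : k ≤ n)
    (ξ : DeFinetti.TensorOp d n) (hξ : DeFinetti.IsDensity ξ)
    (hsymm : DeFinetti.IsPermInvariant ξ) :
    ∃ τ ∈ DeFinetti.productMixtures d k,
      DeFinetti.traceDist (DeFinetti.partialTrace hk ξ) τ
        ≤ 2 * ((d : ℝ) ^ 2 * (k : ℝ) / (n : ℝ)) :=
  DeFinetti.traceDist_partialTrace_le hn hk hξ hsymm
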